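/- For a finite connected graph $G$ let $H(G)=\sum_{\{u,v\}} 1/d(u,v)$ be its Harary index, the sum running over all unordered pairs of distinct vertices $u,v$ of $G$, where $d(u,v)$ is the distance in $G$. For $0\le\Delta\le n-1$ with $n\ge 1$, the broom $B_{n,\Delta}$ is the graph on $n$ vertices consisting of the star with $\Delta$ pendent vertices and a path of length $n-\Delta-1$ attached, by one of its ends, to a pendent vertex of the star (so $B_{n,n-1}$ is the star; $B_{1,0}$ is a single vertex). Let $P_n$ denote the path on $n$ vertices. (1) Let $T$ be a tree on $n$ vertices with maximum degree $\Delta$. Then $B_{n,\Delta}$ is a tree with maximum degree $\Delta$ and $H(T)\ge H(B_{n,\Delta})$, with equality if and only if $T\cong B_{n,\Delta}$. (2) Let $n\ge 4$. Then $B_{n,3}$ has the second minimal Harary index among trees on $n$ vertices, that is: $B_{n,3}$ is a tree, $H(P_n)<H(B_{n,3})$, and every tree $T$ on $n$ vertices that is not isomorphic to $P_n$ satisfies $H(T)\ge H(B_{n,3})$, with equality if and only if $T\cong B_{n,3}$. -/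

import Mathlib

universe u

/-- The Harary index of a finite connected simple graph: the half-sum of the entries `1 / d(u, v)`,
`u ≠ v`, of the reciprocal distance matrix, that is, the sum of `1 / d(u, v)` over all unordered
pairs of distinct vertices. -/
noncomputable def hararyIndex {V : Type*} [Fintype V] [DecidableEq V] (G : SimpleGraph V) : ℝ :=
  (∑ p ∈ (Finset.univ : Finset V).offDiag, 1 / (G.dist p.1 p.2 : ℝ)) / 2

/-- The broom `B_{n,Δ}` on the vertices `0, …, n - 1` (meant for `Δ ≤ n - 1`): the star with
center `0` and pendent vertices `1, …, Δ`, together with the path `Δ, Δ + 1, …, n - 1` of length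
`n - Δ - 1` attached to the pendent vertex `Δ` of the star. -/
def broom (n Δ : ℕ) : SimpleGraph (Fin n) :=
  SimpleGraph.fromRel fun i j : Fin n =>
    (i.val = 0 ∧ j.val ≤ Δ) ∨ (Δ ≤ i.val ∧ j.val = i.val + 1)

instance broomDecidableAdj (n Δ : ℕ) : DecidableRel (broom n Δ).Adj := fun i j =>
  inferInstanceAs (Decidable (i ≠ j ∧
    (((i.val = 0 ∧ j.val ≤ Δ) ∨ (Δ ≤ i.val ∧ j.val = i.val + 1)) ∨
     ((j.val = 0 ∧ i.val ≤ Δ) ∨ (Δ ≤ j.val ∧ i.val = j.val + 1)))))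

/-! ### Distances under isomorphisms and induced embeddings -/

namespace SimpleGraph

variable {V W : Type*} {G : SimpleGraph V} {H : SimpleGraph W}

/-! Fix a vertex `w` of degree at least `Δ` in a tree `T` and delete a vertex `v` farthest from `w`.
The rest is a tree in which `w` still has degree at least `Δ`, and `H(T) = H(T - v) + ∑ 1 / d(v,
x)`, so induction starting from the star reduces the bound to one on the last sum, the reciprocal
status of `v`.

That sum is increasing in the sizes of the balls around `v` (`Connected.reciprocalStatus_eq`). A
ball that is not everything has more vertices than its radius, and the large degree of `w` caps the
eccentricity of `v` (`Connected.dist_add_degree_le`). Both bounds are attained together exactly when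
`v` ends a handle: one vertex at each distance below the cap, all others at the cap. Such a tree is
determined by its order and the cap (`HasHandle.nonempty_iso`), and the broom is one.

For the second minimum, a tree that is not a path has a vertex of degree at least 3, while the path
is the broom with `Δ = 2`. -/

lemma Connected.exists_adj_dist_eq (hG : G.Connected) {v u : V} {k : ℕ}
    (h : G.dist v u = k + 1) : ∃ x, G.Adj x u ∧ G.dist v x = k := by
  obtain ⟨p, hp⟩ := hG.exists_walk_length_eq_dist u v
  rw [dist_comm, h] at hp
  cases p with
  | nil => simp at hp
  | @cons _ x _ hux q =>
    refine ⟨x, hux.symm, ?_⟩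
    have h1 : G.dist x v ≤ k := (dist_le q).trans (by simpa using hp.le)
    have h2 := hG.dist_triangle (u := v) (v := x) (w := u)
    rw [dist_eq_one_iff_adj.2 hux.symm] at h2
    rw [dist_comm] at h1
    omega

lemma Connected.exists_dist_eq (hG : G.Connected) {v u : V} {i : ℕ} (h : i ≤ G.dist v u) :
    ∃ x, G.dist v x = i := by
  obtain ⟨j, hj⟩ := Nat.exists_eq_add_of_le h
  induction j generalizing u with
  | zero => exact ⟨u, hj⟩
  | succ j ih =>
    obtain ⟨x, -, hx⟩ := hG.exists_adj_dist_eq (k := i + j) hj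
    exact ih (by omega) hx

lemma Iso.dist_eq (e : G ≃g H) (x y : V) : H.dist (e x) (e y) = G.dist x y := by
  by_cases h : G.Reachable x y
  · have h' : H.Reachable (e x) (e y) := h.map e.toHom
    apply le_antisymm
    · obtain ⟨p, hp⟩ := h.exists_walk_length_eq_dist
      rw [← hp, ← Walk.length_map e.toHom p]
      exact dist_le _
    · obtain ⟨p, hp⟩ := h'.exists_walk_length_eq_dist
      rw [← hp, ← Walk.length_map e.symm.toHom p]
      simpa using dist_le ((p.map e.symm.toHom).copy (e.symm_apply_apply x) (e.symm_apply_apply y))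
  · rw [dist_eq_zero_of_not_reachable h, dist_eq_zero_of_not_reachable]
    intro h'
    apply h
    simpa using h'.map e.symm.toHom

/-- A connected induced subgraph of an acyclic graph is isometrically embedded. -/
lemma IsAcyclic.dist_embedding (hG : G.IsAcyclic) (hH : H.Connected) (f : H ↪g G) (x y : W) :
    G.dist (f x) (f y) = H.dist x y := by
  obtain ⟨p, hp, hpl⟩ := hH.exists_path_of_dist x y
  have hr : G.Reachable (f x) (f y) := (hH x y).map f.toHom
  obtain ⟨q, hq, hql⟩ := hr.exists_path_of_dist
  have := (hG.subsingleton_path _ _).elim ⟨q, hq⟩ ⟨p.map f.toHom, hp.map f.injective⟩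
  rw [← hpl, ← hql, Subtype.mk.inj this, Walk.length_map]

/-! ### Reciprocal status and ball sizes -/

/-- The number of vertices at distance at most `k` from `v`. -/
noncomputable def closedBallCard [Fintype V] (G : SimpleGraph V) (v : V) (k : ℕ) : ℕ :=
  (Finset.univ.filter fun x => G.dist v x ≤ k).card

/-- The sum of the reciprocal distances from `v` to the other vertices. -/
noncomputable def reciprocalStatus [Fintype V] (G : SimpleGraph V) (v : V) : ℝ :=
  ∑ x, 1 / (G.dist v x : ℝ)

variable [Fintype V] [Fintype W]

lemma _root_.hararyIndex_eq_sum_reciprocalStatus [DecidableEq V] (G : SimpleGraph V) :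
    hararyIndex G = (∑ x, G.reciprocalStatus x) / 2 := by
  unfold hararyIndex reciprocalStatus
  congr 1
  rw [← Finset.sum_product', Finset.univ_product_univ]
  refine Finset.sum_subset (Finset.subset_univ _) ?_
  rintro ⟨x, y⟩ - h
  have : x = y := by simpa using h
  simp [this]

lemma Iso.hararyIndex_eq [DecidableEq V] [DecidableEq W] (e : G ≃g H) :
    hararyIndex G = hararyIndex H := by
  rw [hararyIndex_eq_sum_reciprocalStatus, hararyIndex_eq_sum_reciprocalStatus]
  congr 1
  refine Fintype.sum_equiv e.toEquiv _ _ fun x => Fintype.sum_equiv e.toEquiv _ _ fun y => ?_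
  have := e.dist_eq x y
  simp only [RelIso.coe_fn_toEquiv, this]

/-- Deleting a vertex of a tree without disconnecting it lowers the Harary index by the
reciprocal status of that vertex. -/
lemma IsAcyclic.hararyIndex_eq_add_reciprocalStatus [DecidableEq V] [DecidableEq W]
    (hG : G.IsAcyclic) (hH : H.Connected) (f : H ↪g G) {v : V} (hf : Set.range f = {v}ᶜ) :
    hararyIndex G = hararyIndex H + G.reciprocalStatus v := by
  have key (g : V → ℝ) : ∑ x, g x = g v + ∑ w, g (f w) := by
    rw [Fintype.sum_eq_add_sum_compl v]
    congr 1
    have : ({v}ᶜ : Finset V) = Finset.univ.map f.toEmbedding := by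
      ext x
      have := congrArg (x ∈ ·) hf
      simp only [Set.mem_range, Set.mem_compl_iff, Set.mem_singleton_iff, eq_iff_iff] at this
      simp [← this]
    rw [this, Finset.sum_map]
    rfl
  rw [hararyIndex_eq_sum_reciprocalStatus, hararyIndex_eq_sum_reciprocalStatus, key]
  have h1 : ∀ w, G.reciprocalStatus (f w) = 1 / (G.dist v (f w) : ℝ) + H.reciprocalStatus w := by
    intro w
    unfold reciprocalStatus
    rw [key, dist_comm]
    simp only [hG.dist_embedding hH f]
  have h2 : G.reciprocalStatus v = ∑ w, 1 / (G.dist v (f w) : ℝ) := by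
    unfold reciprocalStatus
    rw [key]
    simp
  -- The reciprocal status of `v` occurs twice, as its own term and spread over the other vertices;
  -- halving leaves one copy.
  simp only [h1, Finset.sum_add_distrib, ← h2]
  ring

lemma Connected.closedBallCard_zero (hG : G.Connected) (v : V) : G.closedBallCard v 0 = 1 := by
  unfold closedBallCard
  rw [Finset.card_eq_one]
  refine ⟨v, ?_⟩
  ext x
  simp [hG.dist_eq_zero_iff, eq_comm]

lemma closedBallCard_eq_card {v : V} {k : ℕ} (h : ∀ x, G.dist v x ≤ k) :
    G.closedBallCard v k = Fintype.card V := by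
  simp [closedBallCard, h]

lemma closedBallCard_succ (v : V) (k : ℕ) : G.closedBallCard v (k + 1) =
    G.closedBallCard v k + (Finset.univ.filter fun x => G.dist v x = k + 1).card := by
  classical
  unfold closedBallCard
  rw [← Finset.card_union_of_disjoint]
  · congr 1
    ext x
    simp
    omega
  · rw [Finset.disjoint_filter]
    intro x _ h
    omega

lemma Connected.le_closedBallCard (hG : G.Connected) (v : V) {k : ℕ}
    (hk : k < Fintype.card V) : k + 1 ≤ G.closedBallCard v k := by
  by_cases h : ∀ x, G.dist v x ≤ k
  · rwa [closedBallCard_eq_card h]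
  push Not at h
  obtain ⟨u, hu⟩ := h
  -- A vertex farther than `k` forces every distance up to `k` to occur; beyond that `v` is a dummy
  -- value.
  have h1 : ∀ i, ∃ x, i ≤ k → G.dist v x = i := fun i => by
    by_cases hi : i ≤ k
    · obtain ⟨x, hx⟩ := hG.exists_dist_eq (hi.trans hu.le)
      exact ⟨x, fun _ => hx⟩
    · exact ⟨v, fun h => absurd h hi⟩
  choose x hx using h1
  have : (Finset.range (k + 1)).card ≤ G.closedBallCard v k := by
    refine Finset.card_le_card_of_injOn x ?_ ?_
    · intro i hi
      have hi : i < k + 1 := by simpa using hi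
      simp only [Finset.coe_filter, Finset.mem_univ, true_and, Set.mem_ofPred_eq]
      rw [hx i (by omega)]
      omega
    · intro i hi j hj hij
      have hi : i < k + 1 := by simpa using hi
      have hj : j < k + 1 := by simpa using hj
      rw [← hx i (by omega), ← hx j (by omega), hij]
  simpa using this

/-- Telescoping of `1 / (k (k + 1)) = 1 / k - 1 / (k + 1)`; the indicator `d ≤ k` becomes a ball
size once summed over vertices. -/
lemma one_div_eq_add_sum_ite {d m : ℕ} (hd : 1 ≤ d) (hdm : d ≤ m) :
    (1 / d : ℝ) = 1 / m + ∑ k ∈ Finset.Ico 1 m, if d ≤ k then 1 / ((k : ℝ) * (k + 1)) else 0 := by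
  induction m, hdm using Nat.le_induction with
  | base =>
    rw [Finset.sum_eq_zero, add_zero]
    intro k hk
    rw [Finset.mem_Ico] at hk
    rw [if_neg (by omega)]
  | succ m hm ih =>
    rw [Finset.sum_Ico_succ_top (by omega), ih, if_pos hm]
    have : (m : ℝ) ≠ 0 := by norm_cast; omega
    push_cast
    field_simp
    ring

/-- Abel summation. The `- 1` removes `v` itself from each ball. -/
lemma Connected.reciprocalStatus_eq (hG : G.Connected) {v : V} {m : ℕ}
    (h : ∀ x, G.dist v x ≤ m) : G.reciprocalStatus v = ((Fintype.card V : ℝ) - 1) / m +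
      ∑ k ∈ Finset.Ico 1 m, ((G.closedBallCard v k : ℝ) - 1) / ((k : ℝ) * (k + 1)) := by
  classical
  have h0 : G.reciprocalStatus v = ∑ x ∈ Finset.univ.erase v, 1 / (G.dist v x : ℝ) := by
    rw [reciprocalStatus, ← Finset.add_sum_erase _ _ (Finset.mem_univ v)]
    simp
  rw [h0, Finset.sum_congr rfl fun x hx => one_div_eq_add_sum_ite
    (hG.pos_dist_of_ne (Finset.ne_of_mem_erase hx).symm) (h x), Finset.sum_add_distrib,
    Finset.sum_comm]
  congr 1
  · have : 1 ≤ Fintype.card V := Fintype.card_pos_iff.2 ⟨v⟩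
    simp [Finset.card_erase_of_mem, Nat.cast_sub this, div_eq_mul_inv]
  · refine Finset.sum_congr rfl fun k _ => ?_
    rw [← Finset.sum_filter, Finset.sum_const, Finset.filter_erase, Finset.card_erase_of_mem
      (by simp), nsmul_eq_mul, Nat.cast_sub, mul_one_div]
    · simp [closedBallCard]
    · exact Finset.card_pos.2 ⟨v, by simp⟩

/-! ### Minimal reciprocal status and handles -/

/-- The least possible reciprocal status of a vertex of eccentricity at most `m` in a connected
graph on `n` vertices. -/
noncomputable def minReciprocalStatus (n m : ℕ) : ℝ :=
  ((n : ℝ) - 1) / m + ∑ k ∈ Finset.Ico 1 m, (k : ℝ) / ((k : ℝ) * (k + 1))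

/-- All vertices are at distance at most `m` from `v`, and for every `k < m` exactly one vertex is
at distance `k` from `v`. -/
def HasHandle (G : SimpleGraph V) (v : V) (m : ℕ) : Prop :=
  (∀ x, G.dist v x ≤ m) ∧ ∀ k < m, G.closedBallCard v k = k + 1

lemma Connected.hasHandle_of_closedBallCard_le (hG : G.Connected) {v : V} {m : ℕ}
    (h : ∀ x, G.dist v x ≤ m) (hm : m ≤ Fintype.card V)
    (hc : ∀ k, 1 ≤ k → k < m → G.closedBallCard v k ≤ k + 1) : G.HasHandle v m := by
  refine ⟨h, fun k hk => ?_⟩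
  rcases Nat.eq_zero_or_pos k with rfl | h0
  · exact hG.closedBallCard_zero v
  · exact (hc k h0 hk).antisymm (hG.le_closedBallCard v (by omega))

lemma HasHandle.reciprocalStatus_eq {v : V} {m : ℕ} (h : G.HasHandle v m) (hG : G.Connected) :
    G.reciprocalStatus v = minReciprocalStatus (Fintype.card V) m := by
  rw [hG.reciprocalStatus_eq h.1, minReciprocalStatus]
  congr 1
  refine Finset.sum_congr rfl fun k hk => ?_
  rw [h.2 k (Finset.mem_Ico.1 hk).2]
  simp

/-- The comparison is termwise with positive weights, so equality pins down every ball size. -/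
lemma Connected.minReciprocalStatus_le (hG : G.Connected) {v : V} {m : ℕ}
    (h : ∀ x, G.dist v x ≤ m) (hm : m ≤ Fintype.card V) :
    minReciprocalStatus (Fintype.card V) m ≤ G.reciprocalStatus v ∧
      (G.reciprocalStatus v = minReciprocalStatus (Fintype.card V) m → G.HasHandle v m) := by
  have key : ∀ k ∈ Finset.Ico 1 m, (k : ℝ) / ((k : ℝ) * (k + 1)) ≤
      ((G.closedBallCard v k : ℝ) - 1) / ((k : ℝ) * (k + 1)) := by
    intro k hk
    rw [Finset.mem_Ico] at hk
    have : ((k + 1 : ℕ) : ℝ) ≤ G.closedBallCard v k :=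
      Nat.cast_le.2 (hG.le_closedBallCard v (by omega))
    push_cast at this
    gcongr
    linarith
  rw [hG.reciprocalStatus_eq h, minReciprocalStatus]
  refine ⟨add_le_add le_rfl (Finset.sum_le_sum key), fun heq => ?_⟩
  refine hG.hasHandle_of_closedBallCard_le h hm fun k h1 hkm => ?_
  have h2 := (Finset.sum_eq_sum_iff_of_le key).1 (add_left_cancel heq).symm k
    (Finset.mem_Ico.2 ⟨h1, hkm⟩)
  have h3 : (0 : ℝ) < (k : ℝ) * (k + 1) := by positivity
  rw [div_left_inj' h3.ne'] at h2
  have : (G.closedBallCard v k : ℝ) = ((k + 1 : ℕ) : ℝ) := by push_cast; linarith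
  exact (Nat.cast_injective this).le

/-- In a connected graph the eccentricities are at most `n + 1 - deg w`, for every vertex `w`. -/
lemma Connected.dist_add_degree_le (hG : G.Connected) (w : V) [Fintype (G.neighborSet w)]
    (v u : V) : G.dist v u + G.degree w ≤ Fintype.card V + 1 := by
  classical
  set e := G.dist v u
  have h1 : ∀ i, ∃ x, i ≤ e → G.dist v x = i := fun i => by
    by_cases hi : i ≤ e
    · obtain ⟨x, hx⟩ := hG.exists_dist_eq hi
      exact ⟨x, fun _ => hx⟩
    · exact ⟨v, fun h => absurd h hi⟩
  choose x hx using h1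
  set d := G.dist v w
  -- The closed neighbourhood of `w` only meets distances `d - 1`, `d`, `d + 1` from `v`. One vertex
  -- at each other distance up to `e` gives at least `e - 2` vertices outside it.
  set S := Finset.range (e + 1) \ {d - 1, d, d + 1} with hS
  have hS1 : e + 1 - 3 ≤ S.card := by
    have h2 := Finset.le_card_sdiff {d - 1, d, d + 1} (Finset.range (e + 1))
    have h3 : ({d - 1, d, d + 1} : Finset ℕ).card ≤ 3 := Finset.card_le_three
    rw [Finset.card_range, ← hS] at h2
    omega
  have hinj : Set.InjOn x S := by
    intro i hi j hj hij
    simp only [hS, Finset.coe_sdiff, Set.mem_sdiff, Finset.mem_coe, Finset.mem_range] at hi hj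
    rw [← hx i (by omega), ← hx j (by omega), hij]
  have hdisj : Disjoint (S.image x) (insert w (G.neighborFinset w)) := by
    rw [Finset.disjoint_left]
    intro y hy hy'
    obtain ⟨i, hi, rfl⟩ := Finset.mem_image.1 hy
    simp only [hS, Finset.mem_sdiff, Finset.mem_range, Finset.mem_insert,
      Finset.mem_singleton, not_or] at hi
    have h4 := hx i (by omega)
    simp only [Finset.mem_insert, mem_neighborFinset] at hy'
    rcases hy' with h5 | h5
    · rw [h5] at h4
      omega
    · have := h5.diff_dist_adj (u := v)
      omega
  have h6 := Finset.card_le_univ (S.image x ∪ insert w (G.neighborFinset w))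
  rw [Finset.card_union_of_disjoint hdisj, Finset.card_image_of_injOn hinj,
    Finset.card_insert_of_notMem (by simp), card_neighborFinset_eq_degree] at h6
  omega

lemma HasHandle.eq_of_dist_eq {v : V} {m : ℕ} (h : G.HasHandle v m) {x y : V}
    (hxy : G.dist v x = G.dist v y) (hm : G.dist v x < m) (hG : G.Connected) : x = y := by
  rcases hk : G.dist v x with _ | k
  · exact (hG.dist_eq_zero_iff.1 hk).symm.trans (hG.dist_eq_zero_iff.1 (hxy ▸ hk))
  · have h1 := G.closedBallCard_succ v k
    rw [h.2 k (by omega), h.2 (k + 1) (by omega)] at h1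
    have h2 : (Finset.univ.filter fun x => G.dist v x = k + 1).card ≤ 1 := by omega
    refine Finset.card_le_one.1 h2 x ?_ y ?_
    · simpa using hk
    · simpa using hxy ▸ hk

/-- Levels below `m` are singletons, so the neighbour one step closer to `v` is forced: levels alone
decide adjacency. -/
lemma HasHandle.adj_iff {v : V} {m : ℕ} (h : G.HasHandle v m) (hG : G.IsTree) {x y : V} :
    G.Adj x y ↔ G.dist v x = G.dist v y + 1 ∨ G.dist v y = G.dist v x + 1 := by
  refine ⟨hG.dist_eq_dist_add_one_of_adj v, ?_⟩
  have key : ∀ x y, G.dist v y = G.dist v x + 1 → G.Adj x y := by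
    intro x y hxy
    obtain ⟨z, hz, hzx⟩ := hG.connected.exists_adj_dist_eq hxy
    have := h.1 y
    rwa [h.eq_of_dist_eq hzx.symm (by omega) hG.connected]
  rintro (h1 | h1)
  · exact (key y x h1).symm
  · exact key x y h1

lemma HasHandle.closedBallCard_eq {v : V} {m : ℕ} (h : G.HasHandle v m) (k : ℕ) :
    G.closedBallCard v k = if k < m then k + 1 else Fintype.card V := by
  split_ifs with hk
  · exact h.2 k hk
  · exact closedBallCard_eq_card fun x => (h.1 x).trans (by omega)

/-- Trees of the same order with handles of the same length are isomorphic. -/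
lemma HasHandle.nonempty_iso {v : V} {w : W} {m : ℕ} (hv : G.HasHandle v m)
    (hw : H.HasHandle w m) (hG : G.IsTree) (hH : H.IsTree)
    (hc : Fintype.card V = Fintype.card W) : Nonempty (G ≃g H) := by
  have hb : ∀ k, G.closedBallCard v k = H.closedBallCard w k := fun k => by
    rw [hv.closedBallCard_eq, hw.closedBallCard_eq, hc]
  have hf : ∀ k, Nonempty ({x // G.dist v x = k} ≃ {y // H.dist w y = k}) := by
    intro k
    rw [← Fintype.card_eq, Fintype.card_subtype, Fintype.card_subtype]
    cases k with
    | zero => simpa only [closedBallCard, Nat.le_zero] using hb 0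
    | succ k =>
      have h1 := G.closedBallCard_succ v k
      have h2 := H.closedBallCard_succ w k
      rw [hb, hb] at h1
      omega
  -- Any level-preserving bijection is an isomorphism, by `HasHandle.adj_iff`.
  let e := Equiv.ofFiberEquiv fun k => (hf k).some
  have he : ∀ x, H.dist w (e x) = G.dist v x := Equiv.ofFiberEquiv_map _
  exact ⟨⟨e, by intro x y; rw [hw.adj_iff hH, hv.adj_iff hG, he, he]⟩⟩

end SimpleGraph

/-! ### Brooms -/

namespace SimpleGraph

/-- Bounds distances from below by an explicit potential, without computing them. -/
lemma Connected.le_add_dist {V : Type*} {G : SimpleGraph V} (hG : G.Connected) (f : V → ℕ)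
    (hf : ∀ x y, G.Adj x y → f x ≤ f y + 1) (v x : V) : f x ≤ f v + G.dist v x := by
  obtain ⟨p, hp⟩ := hG.exists_walk_length_eq_dist x v
  rw [dist_comm, ← hp]
  clear hp
  induction p with
  | nil => simp
  | cons h p ih =>
    have := hf _ _ h
    rw [Walk.length_cons]
    omega

/-- A graph on `Fin n` in which every vertex but `0` has exactly one smaller neighbour is a tree. -/
lemma isTree_of_parent {n : ℕ} (hn : 0 < n) {G : SimpleGraph (Fin n)} (p : Fin n → Fin n)
    (hp : ∀ i : Fin n, i.val ≠ 0 → p i < i ∧ G.Adj i (p i))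
    (hu : ∀ i j : Fin n, j < i → G.Adj i j → j = p i) : G.IsTree := by
  classical
  have hr : ∀ k (hk : k < n), G.Reachable ⟨k, hk⟩ ⟨0, hn⟩ := by
    intro k
    induction k using Nat.strong_induction_on with
    | _ k ih =>
      intro hk
      rcases Nat.eq_zero_or_pos k with rfl | h0
      · rfl
      · obtain ⟨h1, h2⟩ := hp ⟨k, hk⟩ h0.ne'
        exact h2.reachable.trans (ih (p ⟨k, hk⟩) h1 _)
  have hc : G.Connected := by
    rw [connected_iff_exists_forall_reachable]
    exact ⟨⟨0, hn⟩, fun w => (hr w w.2).symm⟩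
  rw [isTree_iff_connected_and_card]
  refine ⟨hc, le_antisymm ?_ hc.card_vert_le_card_edgeSet_add_one⟩
  -- Every edge joins a nonzero vertex to its parent, so there are at most `n - 1` edges.
  have hsub : G.edgeFinset ⊆
      ((Finset.univ : Finset (Fin n)).erase ⟨0, hn⟩).image fun i => s(i, p i) := by
    intro e he
    induction e using Sym2.ind with
    | _ x y =>
      rw [mem_edgeFinset, mem_edgeSet] at he
      rw [Finset.mem_image]
      rcases lt_or_gt_of_ne he.ne with h | h
      · refine ⟨y, ?_, ?_⟩
        · simp [Fin.ext_iff]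
          have : x.val < y.val := h
          omega
        · rw [← hu y x h he.symm, Sym2.eq_swap]
      · refine ⟨x, ?_, ?_⟩
        · simp [Fin.ext_iff]
          have : y.val < x.val := h
          omega
        · rw [← hu x y h he]
  have h1 := (Finset.card_le_card hsub).trans Finset.card_image_le
  rw [Finset.card_erase_of_mem (Finset.mem_univ _), Finset.card_univ, Fintype.card_fin] at h1
  rw [Nat.card_eq_fintype_card, Nat.card_eq_fintype_card, Fintype.card_fin, ← edgeFinset_card]
  omega

section Broom

variable {n Δ : ℕ}

lemma broom_adj {i j : Fin n} : (broom n Δ).Adj i j ↔ i.val ≠ j.val ∧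
    (((i.val = 0 ∧ j.val ≤ Δ) ∨ (Δ ≤ i.val ∧ j.val = i.val + 1)) ∨
     ((j.val = 0 ∧ i.val ≤ Δ) ∨ (Δ ≤ j.val ∧ i.val = j.val + 1))) := by
  rw [broom, fromRel_adj, ne_eq, Fin.ext_iff]

lemma isTree_broom (hn : 0 < n) : (broom n Δ).IsTree := by
  refine isTree_of_parent hn
    (fun i => ⟨if i.val ≤ Δ then 0 else i.val - 1, by split_ifs <;> omega⟩) ?_ ?_
  · intro i hi
    rw [broom_adj, Fin.lt_def]
    dsimp only
    split_ifs <;> omega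
  · intro i j hji h
    rw [broom_adj] at h
    rw [Fin.lt_def] at hji
    rw [Fin.ext_iff]
    dsimp only
    split_ifs <;> omega

lemma le_degree_broom (hn : Δ + 1 ≤ n) : Δ ≤ (broom n Δ).degree ⟨0, by omega⟩ := by
  have : Fintype.card (Fin Δ) ≤ (broom n Δ).degree ⟨0, by omega⟩ := by
    rw [← card_neighborFinset_eq_degree, ← Finset.card_univ]
    refine Finset.card_le_card_of_injOn (fun i => ⟨i.val + 1, by omega⟩) ?_ ?_
    · intro i _
      simp only [Finset.mem_coe, mem_neighborFinset, broom_adj]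
      have := i.isLt
      refine ⟨(Nat.succ_ne_zero _).symm, ?_⟩
      simp only [true_and]
      omega
    · intro i _ j _ h
      simpa [Fin.ext_iff] using h
  simpa using this

lemma degree_le_two {G : SimpleGraph (Fin n)} [DecidableRel G.Adj] (i : Fin n) (a b : ℕ)
    (h : ∀ j, G.Adj i j → j.val = a ∨ j.val = b) : G.degree i ≤ 2 := by
  rw [← card_neighborFinset_eq_degree]
  refine le_trans (Finset.card_le_card_of_injOn (t := {a, b}) Fin.val ?_ ?_) Finset.card_le_two
  · intro j hj
    have := h j (by simpa using hj)
    simpa using this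
  · exact Fin.val_injective.injOn

/-- For `Δ ≤ 1` and `n > Δ + 1` the broom is a path of maximum degree above `Δ`, hence the
disjunction. -/
lemma maxDegree_broom (hn : Δ + 1 ≤ n) (h : 2 ≤ Δ ∨ n = Δ + 1) : (broom n Δ).maxDegree = Δ := by
  refine le_antisymm (maxDegree_le_of_forall_degree_le _ _ fun i => ?_)
    ((le_degree_broom hn).trans (degree_le_maxDegree _ _))
  rcases h with h | rfl
  · by_cases hi : i.val = 0
    · rw [← card_neighborFinset_eq_degree]
      have : ((broom n Δ).neighborFinset i).card ≤ (Finset.Icc 1 Δ).card := by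
        refine Finset.card_le_card_of_injOn Fin.val ?_ Fin.val_injective.injOn
        intro j hj
        simp only [Finset.mem_coe, mem_neighborFinset, broom_adj] at hj
        simp only [Finset.coe_Icc, Set.mem_Icc]
        omega
      simpa using this
    · refine (degree_le_two i (if i.val ≤ Δ then 0 else i.val - 1) (i.val + 1) fun j hj => ?_).trans h
      rw [broom_adj] at hj
      split_ifs <;> omega
  · have := (broom (Δ + 1) Δ).degree_lt_card_verts i
    rw [Fintype.card_fin] at this
    omega

/-- The end of the path of a broom sees a handle of length `n + 1 - Δ`. -/
lemma hasHandle_broom (hΔ : 1 ≤ Δ) (hn : Δ + 1 ≤ n) :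
    (broom (n + 1) Δ).HasHandle (Fin.last n) (n + 2 - Δ) := by
  have hc := (isTree_broom (n := n + 1) (Δ := Δ) n.succ_pos).connected
  -- The distance to the end of the path, for path vertices, the centre and the other leaves
  -- respectively. It is injective below the top value.
  set f : Fin (n + 1) → ℕ := fun u =>
    if Δ ≤ u.val then n - u.val else if u.val = 0 then n + 1 - Δ else n + 2 - Δ with hf
  have hlip := hc.le_add_dist f (fun x y h => by
    rw [broom_adj] at h
    simp only [hf]
    split_ifs <;> omega) (Fin.last n)
  have hlast : f (Fin.last n) = 0 := by
    simp only [hf, Fin.val_last]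
    split_ifs <;> omega
  refine hc.hasHandle_of_closedBallCard_le (fun x => ?_) ?_ fun k _ hk => ?_
  · have h1 := hc.dist_add_degree_le ⟨0, by omega⟩ (Fin.last n) x
    have h2 := le_degree_broom (n := n + 1) (Δ := Δ) (by omega)
    rw [Fintype.card_fin] at h1
    omega
  · rw [Fintype.card_fin]
    omega
  · rw [← Finset.card_range (k + 1), closedBallCard]
    refine Finset.card_le_card_of_injOn f ?_ ?_
    · intro x hx
      have := hlip x
      simp only [Finset.coe_filter, Finset.mem_univ, true_and, Set.mem_ofPred_eq] at hx
      simp only [Finset.coe_range, Set.mem_Iio]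
      omega
    · intro x hx y hy hxy
      have h1 := hlip x
      have h2 := hlip y
      simp only [Finset.coe_filter, Finset.mem_univ, true_and, Set.mem_ofPred_eq] at hx hy
      have h3 : f x ≤ k := by omega
      have h4 : f y ≤ k := by omega
      rw [Fin.ext_iff]
      simp only [hf] at hxy h3 h4
      split_ifs at hxy h3 h4 <;> omega

/-- Deleting the end of the path of a broom gives a broom. -/
def broomEmbedding (n Δ : ℕ) : broom n Δ ↪g broom (n + 1) Δ where
  toEmbedding := Fin.castSuccEmb
  map_rel_iff' := by
    intro i j
    simp [broom_adj]

lemma range_broomEmbedding : Set.range (broomEmbedding n Δ) = {Fin.last n}ᶜ := by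
  ext x
  simp only [Set.mem_range, Set.mem_compl_iff, Set.mem_singleton_iff]
  constructor
  · rintro ⟨y, rfl⟩
    exact (Fin.castSucc_lt_last y).ne
  · intro h
    exact ⟨x.castPred h, Fin.castSucc_castPred x h⟩

lemma hararyIndex_broom_succ (hΔ : 1 ≤ Δ) (hn : Δ + 1 ≤ n) :
    hararyIndex (broom (n + 1) Δ) =
      hararyIndex (broom n Δ) + minReciprocalStatus (n + 1) (n + 2 - Δ) := by
  have hT := isTree_broom (n := n + 1) (Δ := Δ) n.succ_pos
  rw [hT.isAcyclic.hararyIndex_eq_add_reciprocalStatus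
    (isTree_broom (n := n) (by omega)).connected (broomEmbedding n Δ) range_broomEmbedding,
    (hasHandle_broom hΔ hn).reciprocalStatus_eq hT.connected, Fintype.card_fin]

end Broom

/-! ### The induction on the number of vertices -/

lemma dist_le_one_of_card_le_degree_add_one {V : Type*} [Fintype V] {G : SimpleGraph V} {w : V}
    [Fintype (G.neighborSet w)] (h : Fintype.card V ≤ G.degree w + 1) (x : V) :
    G.dist w x ≤ 1 := by
  classical
  have h1 : insert w (G.neighborFinset w) = Finset.univ := by
    rw [← Finset.card_eq_iff_eq_univ]
    refine le_antisymm (Finset.card_le_univ _) ?_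
    rwa [Finset.card_insert_of_notMem (by simp), card_neighborFinset_eq_degree]
  have h2 := Finset.mem_univ x
  rw [← h1, Finset.mem_insert, mem_neighborFinset] at h2
  rcases h2 with rfl | h2
  · simp
  · exact (dist_eq_one_iff_adj.2 h2).le

lemma Connected.hasHandle_one {V : Type*} [Fintype V] {G : SimpleGraph V} (hG : G.Connected)
    {w : V} [Fintype (G.neighborSet w)] (h : Fintype.card V ≤ G.degree w + 1) :
    G.HasHandle w 1 := by
  refine ⟨dist_le_one_of_card_le_degree_add_one h, fun k hk => ?_⟩
  obtain rfl : k = 0 := by omega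
  exact hG.closedBallCard_zero w

/-- Deleting a vertex farthest from a given vertex does not disconnect a connected graph. -/
lemma Connected.connected_induce_compl_of_farthest {V : Type*} {G : SimpleGraph V}
    (hG : G.Connected) {w v : V} (hwv : w ≠ v) (h : ∀ x, G.dist w x ≤ G.dist w v) :
    (G.induce ({v}ᶜ : Set V)).Connected := by
  rw [connected_iff_exists_forall_reachable]
  refine ⟨⟨w, hwv⟩, ?_⟩
  have key : ∀ k x (hx : x ≠ v), G.dist w x = k →
      (G.induce ({v}ᶜ : Set V)).Reachable ⟨w, hwv⟩ ⟨x, hx⟩ := by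
    intro k
    induction k with
    | zero =>
      intro x hx h0
      obtain rfl := hG.dist_eq_zero_iff.1 h0
      rfl
    | succ k ih =>
      intro x hx hk
      obtain ⟨y, hyx, hy⟩ := hG.exists_adj_dist_eq hk
      have hyv : y ≠ v := by
        rintro rfl
        have := h x
        omega
      refine (ih y hyv hy).trans (Adj.reachable ?_)
      exact hyx
  rintro ⟨x, hx⟩
  exact key _ x hx rfl

/-- A tree on `n` vertices with a vertex of degree at least `Δ` has at least the Harary index of
the broom, with equality only for the broom. -/
theorem IsTree.hararyIndex_broom_le {Δ n : ℕ} (hn : Δ + 1 ≤ n) :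
    (2 ≤ Δ ∨ n = Δ + 1) → ∀ (V : Type u) [Fintype V] [DecidableEq V] (T : SimpleGraph V)
    [DecidableRel T.Adj] (w : V), Fintype.card V = n → T.IsTree → Δ ≤ T.degree w →
      hararyIndex (broom n Δ) ≤ hararyIndex T ∧
      (hararyIndex T = hararyIndex (broom n Δ) → Nonempty (T ≃g broom n Δ)) := by
  induction n, hn using Nat.le_induction with
  | base =>
    intro _ V _ _ T _ w hV hT hw
    have hB := isTree_broom (n := Δ + 1) (Δ := Δ) Δ.succ_pos
    have hd := le_degree_broom (n := Δ + 1) (Δ := Δ) le_rfl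
    obtain ⟨e⟩ := (hT.connected.hasHandle_one (w := w) (by omega)).nonempty_iso
      (hB.connected.hasHandle_one (w := ⟨0, by omega⟩) (by rw [Fintype.card_fin]; omega)) hT hB
      (by rw [hV, Fintype.card_fin])
    exact ⟨e.hararyIndex_eq.ge, fun _ => ⟨e⟩⟩
  | succ n hn ih =>
    intro h2 V _ _ T _ w hV hT hw
    replace h2 : 2 ≤ Δ := by omega
    have : Nonempty V := ⟨w⟩
    obtain ⟨v, hv⟩ := Finite.exists_max (T.dist w)
    have hwv : w ≠ v := by
      rintro rfl
      have h3 : 0 < T.degree w := by omega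
      obtain ⟨x, hx⟩ := (T.degree_pos_iff_exists_adj w).1 h3
      have := hv x
      rw [dist_eq_one_iff_adj.2 hx] at this
      simp at this
    have hc := hT.connected.connected_induce_compl_of_farthest hwv hv
    have hS := hT.isAcyclic.hararyIndex_eq_add_reciprocalStatus hc
      (Embedding.induce ({v}ᶜ : Set V)) (v := v) Subtype.range_val
    have hdeg : Δ ≤ (T.induce ({v}ᶜ : Set V)).degree ⟨w, hwv⟩ := by
      have h3 : (T.neighborFinset w).erase v ⊆
          ((T.induce ({v}ᶜ : Set V)).neighborFinset ⟨w, hwv⟩).image Subtype.val := by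
        intro x hx
        simp only [Finset.mem_erase, mem_neighborFinset] at hx
        simp only [Finset.mem_image, mem_neighborFinset]
        exact ⟨⟨x, hx.1⟩, hx.2, rfl⟩
      have h4 := (Finset.card_le_card h3).trans Finset.card_image_le
      rw [card_neighborFinset_eq_degree] at h4
      -- If the farthest vertex is a neighbour of `w`, then `T` is a star with `n` leaves, and `n -
      -- 1 ≥ Δ` of them survive. Otherwise `w` loses no neighbour.
      by_cases hadj : T.Adj w v
      · have h5 : T.neighborFinset w = Finset.univ.erase w := by
          ext x
          simp only [mem_neighborFinset, Finset.mem_erase, Finset.mem_univ, and_true]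
          refine ⟨fun h => h.ne', fun h => ?_⟩
          have h6 := hv x
          rw [dist_eq_one_iff_adj.2 hadj] at h6
          have h7 := hT.connected.pos_dist_of_ne h.symm
          exact dist_eq_one_iff_adj.1 (by omega)
        rw [Finset.card_erase_of_mem (by simpa using hadj), h5,
          Finset.card_erase_of_mem (Finset.mem_univ _), Finset.card_univ] at h4
        omega
      · rw [Finset.erase_eq_of_notMem (by simpa using hadj), card_neighborFinset_eq_degree] at h4
        omega
    -- The equality case for `T - v` is not needed: equality in the status of `v` already gives a
    -- handle in `T`, which determines `T`.
    obtain ⟨ih1, -⟩ := ih (.inl h2) ({v}ᶜ : Set V) (T.induce ({v}ᶜ : Set V)) ⟨w, hwv⟩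
      (by rw [Fintype.card_compl_set]; simp [hV]) ⟨hc, hT.isAcyclic.induce _⟩ hdeg
    obtain ⟨h8, h9⟩ := hT.connected.minReciprocalStatus_le (v := v) (m := n + 2 - Δ)
      (fun x => by
        have := hT.connected.dist_add_degree_le w v x
        omega) (by omega)
    rw [hV] at h8 h9
    rw [hararyIndex_broom_succ (by omega) hn, hS]
    refine ⟨add_le_add ih1 h8, fun heq => ?_⟩
    exact (h9 (by linarith)).nonempty_iso (hasHandle_broom (by omega) hn) hT
      (isTree_broom n.succ_pos) (by rw [hV, Fintype.card_fin])

/-! ### Paths and trees of small degree -/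

lemma isTree_pathGraph {n : ℕ} (hn : 0 < n) : (pathGraph n).IsTree := by
  refine isTree_of_parent hn (fun i => ⟨i.val - 1, by omega⟩) ?_ ?_
  · intro i hi
    rw [pathGraph_adj, Fin.lt_def]
    dsimp only
    omega
  · intro i j hji h
    rw [pathGraph_adj] at h
    rw [Fin.lt_def] at hji
    rw [Fin.ext_iff]
    dsimp only
    omega

/-- Seen from a leaf, each level has at most one vertex: two vertices on a level would share their
predecessor, whose own predecessor is a third neighbour. -/
lemma IsTree.exists_hasHandle_of_degree_le_two {V : Type*} [Fintype V] [Nontrivial V]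
    {T : SimpleGraph V} [DecidableRel T.Adj] (hT : T.IsTree) (h : ∀ x, T.degree x ≤ 2) :
    ∃ v, T.HasHandle v (Fintype.card V) := by
  classical
  obtain ⟨v, hv⟩ := hT.exists_vert_degree_one_of_nontrivial
  have hc := hT.connected
  have hlevel : ∀ k x y, T.dist v x = k → T.dist v y = k → x = y := by
    intro k
    induction k using Nat.strong_induction_on with
    | _ k ih =>
      intro x y hx hy
      match k with
      | 0 => exact (hc.dist_eq_zero_iff.1 hx).symm.trans (hc.dist_eq_zero_iff.1 hy)
      | 1 =>
        rw [dist_eq_one_iff_adj] at hx hy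
        rw [← card_neighborFinset_eq_degree] at hv
        exact Finset.card_le_one.1 hv.le x (by simpa using hx) y (by simpa using hy)
      | k + 2 =>
        obtain ⟨p, hpx, hp⟩ := hc.exists_adj_dist_eq (k := k + 1) hx
        obtain ⟨q, hqy, hq⟩ := hc.exists_adj_dist_eq (k := k + 1) hy
        obtain rfl := ih (k + 1) (by omega) p q hp hq
        obtain ⟨r, hrp, hr⟩ := hc.exists_adj_dist_eq hp
        by_contra hne
        have hrx : r ≠ x := by rintro rfl; omega
        have hry : r ≠ y := by rintro rfl; omega
        have h3 : ({r, x, y} : Finset V).card = 3 := Finset.card_eq_three.2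
          ⟨r, x, y, hrx, hry, hne, rfl⟩
        have h4 : ({r, x, y} : Finset V) ⊆ T.neighborFinset p := by
          intro z hz
          simp only [Finset.mem_insert, Finset.mem_singleton] at hz
          rw [mem_neighborFinset]
          rcases hz with rfl | rfl | rfl
          exacts [hrp.symm, hpx, hqy]
        have h5 := Finset.card_le_card h4
        rw [card_neighborFinset_eq_degree] at h5
        have := h p
        omega
  refine ⟨v, hc.hasHandle_of_closedBallCard_le (fun x => ?_) le_rfl fun k _ _ => ?_⟩
  · have := hc.dist_add_degree_le v v x
    omega
  · rw [← Finset.card_range (k + 1), closedBallCard]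
    refine Finset.card_le_card_of_injOn (T.dist v) ?_ ?_
    · intro x hx
      simp only [Finset.coe_filter, Finset.mem_univ, true_and, Set.mem_ofPred_eq] at hx
      simp only [Finset.coe_range, Set.mem_Iio]
      omega
    · intro x _ y _ hxy
      exact hlevel _ x y hxy rfl

/-- A tree without vertices of degree three or more is a path. -/
lemma IsTree.nonempty_iso_pathGraph {V : Type*} [Fintype V] {T : SimpleGraph V}
    [DecidableRel T.Adj] (hT : T.IsTree) (h : ∀ x, T.degree x ≤ 2) {n : ℕ} (hn : 2 ≤ n)
    (hV : Fintype.card V = n) : Nonempty (T ≃g pathGraph n) := by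
  classical
  have : Nontrivial V := Fintype.one_lt_card_iff_nontrivial.1 (by omega)
  have : Nontrivial (Fin n) := Fintype.one_lt_card_iff_nontrivial.1 (by rw [Fintype.card_fin]; omega)
  have hP := isTree_pathGraph (n := n) (by omega)
  obtain ⟨v, hv⟩ := hT.exists_hasHandle_of_degree_le_two h
  obtain ⟨w, hw⟩ := hP.exists_hasHandle_of_degree_le_two fun i =>
    degree_le_two i (i.val - 1) (i.val + 1) fun j hj => by rw [pathGraph_adj] at hj; omega
  rw [hV] at hv
  rw [Fintype.card_fin] at hw
  exact hv.nonempty_iso hw hT hP (by rw [hV, Fintype.card_fin])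

/-- Handshake: `2 (n - 1) ≤ n Δ` leaves only one or two vertices when `Δ ≤ 1`. -/
lemma IsTree.card_eq_maxDegree_add_one {V : Type*} [Fintype V] {T : SimpleGraph V}
    [DecidableRel T.Adj] (hT : T.IsTree) (h : T.maxDegree < 2) :
    Fintype.card V = T.maxDegree + 1 := by
  classical
  have := hT.connected.nonempty
  obtain ⟨w, hw⟩ := T.exists_maximal_degree_vertex
  have h1 := T.degree_lt_card_verts w
  have h2 := T.sum_degrees_eq_twice_card_edges
  have h3 := hT.card_edgeFinset
  have h4 : ∑ x, T.degree x ≤ ∑ _x : V, T.maxDegree :=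
    Finset.sum_le_sum fun x _ => T.degree_le_maxDegree x
  rw [Finset.sum_const, Finset.card_univ, smul_eq_mul] at h4
  interval_cases T.maxDegree <;> omega

end SimpleGraph

/-! ### The theorem -/

open SimpleGraph in
theorem theorem3p10 (n : ℕ) :
    -- extremality of the broom among trees on `n` vertices with maximum degree `Δ`
    (∀ (Δ : ℕ) (V : Type u) [Fintype V] [DecidableEq V] (T : SimpleGraph V) [DecidableRel T.Adj],
      Fintype.card V = n → T.IsTree → T.maxDegree = Δ →
        (broom n Δ).IsTree ∧ (broom n Δ).maxDegree = Δ ∧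
        hararyIndex (broom n Δ) ≤ hararyIndex T ∧
        (hararyIndex T = hararyIndex (broom n Δ) ↔ Nonempty (T ≃g broom n Δ))) ∧
    -- `B_{n,3}` is second, immediately after the path, among all trees on `n` vertices
    (4 ≤ n →
      (broom n 3).IsTree ∧
      hararyIndex (SimpleGraph.pathGraph n) < hararyIndex (broom n 3) ∧
      ∀ (V : Type u) [Fintype V] [DecidableEq V] (T : SimpleGraph V),
        Fintype.card V = n → T.IsTree → ¬ Nonempty (T ≃g SimpleGraph.pathGraph n) →
          hararyIndex (broom n 3) ≤ hararyIndex T ∧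
          (hararyIndex T = hararyIndex (broom n 3) ↔ Nonempty (T ≃g broom n 3))) := by
  refine ⟨?_, fun hn => ⟨isTree_broom (by omega), ?_, ?_⟩⟩
  · intro Δ V _ _ T _ hV hT hΔ
    have := hT.connected.nonempty
    obtain ⟨w, hw⟩ := T.exists_maximal_degree_vertex
    have h1 := T.degree_lt_card_verts w
    have h2 : Δ + 1 ≤ n := by omega
    have h3 : 2 ≤ Δ ∨ n = Δ + 1 := by
      by_contra hcon
      have := hT.card_eq_maxDegree_add_one (by omega)
      omega
    obtain ⟨h4, h5⟩ := IsTree.hararyIndex_broom_le h2 h3 V T w hV hT (by omega)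
    exact ⟨isTree_broom (by omega), maxDegree_broom h2 h3, h4, h5, fun ⟨e⟩ => e.hararyIndex_eq⟩
  -- `B_{n,2}` stands in for the path. The bound for `Δ = 2` applies to `B_{n,3}`, and it is strict
  -- because the maximum degrees differ.
  · have hB2 := isTree_broom (n := n) (Δ := 2) (by omega)
    have hB3 := isTree_broom (n := n) (Δ := 3) (by omega)
    have hm2 := maxDegree_broom (n := n) (Δ := 2) (by omega) (.inl le_rfl)
    have hm3 := maxDegree_broom (n := n) (Δ := 3) (by omega) (.inl (by omega))
    have hd3 := le_degree_broom (n := n) (Δ := 3) (by omega)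
    obtain ⟨e⟩ := hB2.nonempty_iso_pathGraph
      (fun x => ((broom n 2).degree_le_maxDegree x).trans hm2.le) (by omega) (Fintype.card_fin n)
    rw [← e.hararyIndex_eq]
    obtain ⟨h4, h5⟩ := IsTree.hararyIndex_broom_le (Δ := 2) (n := n) (by omega) (.inl le_rfl)
      (Fin n) (broom n 3) ⟨0, by omega⟩ (Fintype.card_fin n) hB3 (by omega)
    refine lt_of_le_of_ne h4 fun heq => ?_
    obtain ⟨f⟩ := h5 heq.symm
    have := f.maxDegree_eq
    omega
  · intro V _ _ T hV hT hP
    classical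
    have : ∃ w, 3 ≤ T.degree w := by
      by_contra! hcon
      exact hP (hT.nonempty_iso_pathGraph (fun x => Nat.le_of_lt_succ (hcon x)) (by omega) hV)
    obtain ⟨w, hw⟩ := this
    obtain ⟨h4, h5⟩ := IsTree.hararyIndex_broom_le (Δ := 3) (n := n) hn (.inl (by omega))
      V T w hV hT hw
    exact ⟨h4, h5, fun ⟨e⟩ => e.hararyIndex_eq⟩
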